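/- Fix integers $n,\ell\ge 0$. Let $\mathcal G$ be the set of undirected simple graphs $G$ with vertex set $V=\{1,\dots,n\}$ and vertex labels $\mathsf{col}_G:V\to\mathbb R^\ell$. Double braces denote multisets. Colour refinement: $\mathsf{cr}^{(0)}(G,v)=\mathsf{col}_G(v)$, $\mathsf{cr}^{(t+1)}(G,v)=\bigl(\mathsf{cr}^{(t)}(G,v),\{\!\{\mathsf{cr}^{(t)}(G,u): u \text{ adjacent to } v\}\!\}\bigr)$, and $\mathsf{gcr}^{(t)}(G)=\{\!\{\mathsf{cr}^{(t)}(G,v): v\in V\}\!\}$. $k$-WL (folklore version): the atomic type $\mathsf{atp}_k(G,\mathbf v)$ of $\mathbf v\in V^k$ records, for all $i<j$, whether $v_i=v_j$ and whether $v_i,v_j$ are adjacent, and the labels $\mathsf{col}_G(v_i)$ for all $i$. Put $\mathsf{wl}_k^{(0)}(G,\mathbf v)=\mathsf{atp}_k(G,\mathbf v)$ and $$\mathsf{wl}_k^{(t+1)}(G,\mathbf v)=\Bigl(\mathsf{wl}_k^{(t)}(G,\mathbf v),\{\!\{(\mathsf{atp}_{k+1}(G,\mathbf v u),\mathsf{wl}_k^{(t)}(G,\mathbf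 v[u/1]),\dots,\mathsf{wl}_k^{(t)}(G,\mathbf v[u/k])): u\in V\}\!\}\Bigr),$$ where $\mathbf v[u/i]$ is $\mathbf v$ with its $i$-th entry replaced by $u$. Let $\mathsf{gwl}_k^{(t)}(G)=\{\!\{\mathsf{wl}_k^{(t)}(G,\mathbf v):\mathbf v\in V^k\}\!\}$. The stable label $\mathsf{wl}_k^{(\infty)}(G,\mathbf v)$ is the sequence $(\mathsf{wl}_k^{(t)}(G,\mathbf v))_{t\ge 0}$ (so two tuples have the same stable label iff no round separates them), and $\mathsf{gwl}_k^{(\infty)}(G)=\{\!\{\mathsf{wl}_k^{(\infty)}(G,\mathbf v):\mathbf v\in V^k\}\!\}$. Tensor language: let $\Omega$ be a set of functions $f:\mathbb R^p\to\mathbb R$ of arbitrary finite arities $p$. $\mathsf{TL}_m(\Omega)$ is the set of expressions over the index variables $x_1,\dots,x_m$ given by the grammar $$\varphi ::= \mathbf 1_{x=y}\mid \mathbf 1_{x\ne y}\mid E(x,y)\mid P_s(x)\mid \varphi\cdot\varphi\mid\varphi+\varphi\mid a\cdot\varphi\mid f(\varphi,\dots,\varphi)\mid \textstyle\sum_x\varphi\qquad(1\le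 s\le\ell,\ a\in\mathbb R,\ f\in\Omega).$$ Given $G$ and a valuation of the variables by vertices, $E(x,y)$ is the $0/1$ indicator of adjacency, $P_s(x)$ is the $s$-th coordinate of the label of $x$, $\mathbf 1_{x=y}$ and $\mathbf 1_{x\ne y}$ are $0/1$ indicators, $\sum_x$ sums over all values of $x$ in $V$ and binds $x$, and the other constructs are evaluated pointwise. The summation depth of an expression is the nesting depth of its summations; $\mathsf{TL}_m^{(t)}(\Omega)$ is the set of expressions in $\mathsf{TL}_m(\Omega)$ of summation depth at most $t$. For a set $\mathcal F$ of functions on $\mathcal G$ let $\rho_0(\mathcal F)=\{(G,H)\in\mathcal G^2: f(G)=f(H)\text{ for all } f\in\mathcal F\}$, and write $\rho_0(f)$ for $\rho_0(\{f\})$. For a set $\mathcal L$ of expressions, $\rho_0(\mathcal L)$ is $\rho_0$ of the set of all functions $\mathcal G\to\mathbb R^d$, $d\in\mathbb N$, whose coordinates are given by expressions in $\mathcal L$ without free index variables. **Theorem.** For all $t\ge 0$, $k\ge 1$ and any collection $\Omega$ of functions: (1) $\rho_0\bigl(\mathsf{gcr}^{(t)}\bigr)=\rho_0\bigl(\mathsf{TL}_2^{(t+1)}(\Omega)\bigr)=\rho_0\bigl(\mathsf{gwl}_1^{(t)}\bigr)$;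 (2) $\rho_0\bigl(\mathsf{gwl}_k^{(\infty)}\bigr)=\rho_0\bigl(\mathsf{TL}_{k+1}(\Omega)\bigr)$. -/

import Mathlib

/-! Vertex-labelled graphs, color refinement, the (folklore) Weisfeiler-Leman algorithms, tensor
language expressions, and the separation power of sets of graph functions. -/

namespace TensorLang

/-- An undirected simple graph on `n` vertices with a vertex-labelling in `ℝ^ℓ`. -/
structure LabelledGraph (n ℓ : ℕ) where
  /-- the adjacency structure -/
  graph : SimpleGraph (Fin n)
  /-- the vertex-labelling -/
  col : Fin n → Fin ℓ → ℝ

/-! ### Color refinement -/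

/-- The labels used by color refinement in round `t`. -/
def CRLabel (ℓ : ℕ) : ℕ → Type
  | 0 => Fin ℓ → ℝ
  | t + 1 => CRLabel ℓ t × Multiset (CRLabel ℓ t)

open Classical in
/-- The vertex label after `t` rounds of color refinement. -/
noncomputable def cr {n ℓ : ℕ} : (t : ℕ) → LabelledGraph n ℓ → Fin n → CRLabel ℓ t
  | 0, G, v => G.col v
  | t + 1, G, v => (cr t G v, (G.graph.neighborFinset v).val.map fun u => cr t G u)

/-- The graph label after `t` rounds of color refinement. -/
noncomputable def gcr {n ℓ : ℕ} (t : ℕ) (G : LabelledGraph n ℓ) : Multiset (CRLabel ℓ t) :=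
  (Finset.univ : Finset (Fin n)).val.map fun v => cr t G v

/-! ### The `k`-dimensional Weisfeiler-Leman algorithm -/

/-- The pairs of positions `i < j` in a `k`-tuple. -/
abbrev PosPair (k : ℕ) : Type := {p : Fin k × Fin k // p.1 < p.2}

/-- Atomic types of `k`-tuples: `k.choose 2` entries for the equality type, `k.choose 2` entries for
adjacencies, and the `k` labels in `ℝ^ℓ`. -/
abbrev AtomicType (k ℓ : ℕ) : Type :=
  (PosPair k → ℝ) × (PosPair k → ℝ) × (Fin k → Fin ℓ → ℝ)

open Classical in
/-- The atomic type of a `k`-tuple of vertices. -/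
noncomputable def atp {n ℓ : ℕ} (k : ℕ) (G : LabelledGraph n ℓ) (v : Fin k → Fin n) :
    AtomicType k ℓ :=
  (fun p => if v p.1.1 = v p.1.2 then 1 else 0,
   fun p => if G.graph.Adj (v p.1.1) (v p.1.2) then 1 else 0,
   fun i => G.col (v i))

/-- The labels used by the `k`-dimensional Weisfeiler-Leman algorithm in round `t`. -/
def WLLabel (k ℓ : ℕ) : ℕ → Type
  | 0 => AtomicType k ℓ
  | t + 1 => WLLabel k ℓ t × Multiset (AtomicType (k + 1) ℓ × (Fin k → WLLabel k ℓ t))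

/-- The label of a `k`-tuple after `t` rounds of the (folklore) `k`-dimensional Weisfeiler-Leman
algorithm. -/
noncomputable def wl {n ℓ : ℕ} (k : ℕ) :
    (t : ℕ) → LabelledGraph n ℓ → (Fin k → Fin n) → WLLabel k ℓ t
  | 0, G, v => atp k G v
  | t + 1, G, v =>
    (wl k t G v,
     (Finset.univ : Finset (Fin n)).val.map fun u =>
      (atp (k + 1) G (Fin.snoc (α := fun _ => Fin n) v u),
       fun i : Fin k => wl k t G (Function.update v i u)))

/-- The graph label after `t` rounds of the `k`-dimensional Weisfeiler-Leman algorithm. -/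
noncomputable def gwl {n ℓ : ℕ} (k t : ℕ) (G : LabelledGraph n ℓ) : Multiset (WLLabel k ℓ t) :=
  (Finset.univ : Finset (Fin k → Fin n)).val.map fun v => wl k t G v

/-- The stable label of a `k`-tuple, obtained by an arbitrary number of rounds: it records the labels
of all rounds, so that two tuples have the same stable label iff no round separates them. -/
noncomputable def wlStable {n ℓ : ℕ} (k : ℕ) (G : LabelledGraph n ℓ) (v : Fin k → Fin n) :
    (t : ℕ) → WLLabel k ℓ t :=
  fun t => wl k t G v

/-- The graph label obtained from the stable labels of the `k`-tuples. -/
noncomputable def gwlStable {n ℓ : ℕ} (k : ℕ) (G : LabelledGraph n ℓ) :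
    Multiset ((t : ℕ) → WLLabel k ℓ t) :=
  (Finset.univ : Finset (Fin k → Fin n)).val.map fun v => wlStable k G v

/-! ### Tensor language -/

/-- Collections of real functions of arbitrary finite arities. -/
abbrev FunCollection : Type := Set (Σ p : ℕ, (Fin p → ℝ) → ℝ)

/-- Tensor language expressions over functions in `Ω` with index variables in `X`, for `ℓ` vertex
predicates. -/
inductive Expr (ℓ : ℕ) (Ω : FunCollection) (X : Type) : Type
  /-- the equality predicate -/
  | eq (x y : X) : Expr ℓ Ω X
  /-- the disequality predicate -/
  | ne (x y : X) : Expr ℓ Ω X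
  /-- the edge predicate -/
  | edge (x y : X) : Expr ℓ Ω X
  /-- the vertex predicates -/
  | lab (s : Fin ℓ) (x : X) : Expr ℓ Ω X
  /-- products -/
  | mul (φ ψ : Expr ℓ Ω X) : Expr ℓ Ω X
  /-- sums of two expressions -/
  | add (φ ψ : Expr ℓ Ω X) : Expr ℓ Ω X
  /-- scalar multiples -/
  | smul (a : ℝ) (φ : Expr ℓ Ω X) : Expr ℓ Ω X
  /-- function applications -/
  | app (f : Ω) (φ : Fin f.1.1 → Expr ℓ Ω X) : Expr ℓ Ω X
  /-- summation over an index variable -/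
  | sum (x : X) (φ : Expr ℓ Ω X) : Expr ℓ Ω X

namespace Expr

variable {ℓ : ℕ} {Ω : FunCollection} {X : Type}

/-- The free index variables. -/
def free : Expr ℓ Ω X → Set X
  | eq x y => {x, y}
  | ne x y => {x, y}
  | edge x y => {x, y}
  | lab _ x => {x}
  | mul φ ψ => free φ ∪ free ψ
  | add φ ψ => free φ ∪ free ψ
  | smul _ φ => free φ
  | app _ φ => ⋃ i, free (φ i)
  | sum x φ => free φ \ {x}

/-- The summation depth. -/
def sd : Expr ℓ Ω X → ℕ
  | eq _ _ => 0
  | ne _ _ => 0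
  | edge _ _ => 0
  | lab _ _ => 0
  | mul φ ψ => max (sd φ) (sd ψ)
  | add φ ψ => max (sd φ) (sd ψ)
  | smul _ φ => sd φ
  | app _ φ => Finset.univ.sup fun i => sd (φ i)
  | sum _ φ => sd φ + 1

open Classical in
/-- The value of an expression on a graph relative to a valuation of the index variables. -/
noncomputable def eval [DecidableEq X] {n : ℕ} (G : LabelledGraph n ℓ) : Expr ℓ Ω X → (X → Fin n) → ℝ
  | eq x y, ν => if ν x = ν y then 1 else 0
  | ne x y, ν => if ν x ≠ ν y then 1 else 0
  | edge x y, ν => if G.graph.Adj (ν x) (ν y) then 1 else 0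
  | lab s x, ν => G.col (ν x) s
  | mul φ ψ, ν => eval G φ ν * eval G ψ ν
  | add φ ψ, ν => eval G φ ν + eval G ψ ν
  | smul a φ, ν => a * eval G φ ν
  | app f φ, ν => f.1.2 fun i => eval G (φ i) ν
  | sum x φ, ν => ∑ v : Fin n, eval G φ (Function.update ν x v)

end Expr

/-- The fragment with the `m` index variables `x_1, …, x_m`. -/
def TL (ℓ m : ℕ) (Ω : FunCollection) : Set (Expr ℓ Ω (Fin m)) := Set.univ

/-- The expressions with index variables `x_1, …, x_m` of summation depth at most `t`. -/
def TLDepth (ℓ m t : ℕ) (Ω : FunCollection) : Set (Expr ℓ Ω (Fin m)) := {φ ∈ TL ℓ m Ω | φ.sd ≤ t}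

/-! ### Separation power at graph level -/

/-- A function on the graphs of size `n`, together with its codomain. -/
abbrev GraphFun (n ℓ : ℕ) : Type 1 := Σ β : Type, (LabelledGraph n ℓ → β)

/-- The pairs of graphs which no function in `F` separates. -/
def rho0 {n ℓ : ℕ} (F : Set (GraphFun n ℓ)) : Set (LabelledGraph n ℓ × LabelledGraph n ℓ) :=
  {p | ∀ f ∈ F, f.2 p.1 = f.2 p.2}

/-- A graph function `f : 𝒢 → ℝ^d` is represented in a class `L` of expressions if it is given by
`d` expressions in `L` without free index variables. The value of such an expression does not depend
on the valuation. -/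
def Represented {n ℓ d : ℕ} {Ω : FunCollection} {X : Type} [DecidableEq X] (L : Set (Expr ℓ Ω X))
    (f : LabelledGraph n ℓ → Fin d → ℝ) : Prop :=
  ∃ φ : Fin d → Expr ℓ Ω X, (∀ j, φ j ∈ L ∧ (φ j).free = ∅) ∧
    ∀ (G : LabelledGraph n ℓ) (ν : X → Fin n), f G = fun j => (φ j).eval G ν

/-- All graph functions into some `ℝ^d` that are represented in `L`. -/
def graphFuns (n : ℕ) {ℓ : ℕ} {Ω : FunCollection} {X : Type} [DecidableEq X] (L : Set (Expr ℓ Ω X)) :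
    Set (GraphFun n ℓ) :=
  {F | ∃ (d : ℕ) (f : LabelledGraph n ℓ → Fin d → ℝ),
    Represented L f ∧ F = ⟨Fin d → ℝ, f⟩}

end TensorLang

/-! Two labellings have the same multiset of labels iff some bijection preserves labels, so
refinement becomes a bijective pebble game, while a sum over all vertices can be reindexed along any
bijection. Hence labels bound expressions: suppose a relation between valuations preserves atomic
formulas and drops by only one round when a variable is moved along a suitable bijection. Then
expressions of summation depth at most the number of rounds agree on related valuations
(`eval_eq_of_forall_perm`). The relations are `WLEquiv` and `CREquiv`; for the latter, equality of
`gcr` also matches the non-neighbours.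

Conversely, two graphs realise only finitely many labels, so polynomials in separating functions
give every function of a label, and no function from `Ω` is needed. A multiplicity in a round `t +
1` label is the sum, over one spare variable, of a product of indicators of round `t` labels
(`definable_wl`). Summing out the `k` entries computes the multiplicities in `gwl k t` at depth `t +
k`, which is `t + 1` for `k = 1`. Part (1) is then a cycle of inclusions, closed by reading colour
refinement off 1-WL; part (2) ranges over all rounds. -/

namespace TensorLang

/-! ### Label-preserving bijections, and the pebble game for `k`-WL -/

section WeisfeilerLeman

variable {n ℓ k : ℕ} {G H : LabelledGraph n ℓ}

/-- Equal multiplicities make corresponding fibres equinumerous, and bijections between fibres glue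
to a permutation. -/
theorem map_univ_val_eq_iff {α β : Type*} [Fintype α] {f g : α → β} :
    (Finset.univ : Finset α).val.map f = (Finset.univ : Finset α).val.map g ↔
      ∃ σ : Equiv.Perm α, ∀ a, f a = g (σ a) := by
  classical
  constructor
  · intro h
    have hcard : ∀ b, Fintype.card {a // f a = b} = Fintype.card {a // g a = b} := by
      intro b
      have := congrArg (Multiset.count b) h
      simpa only [Multiset.count_map, Fintype.card_subtype, Finset.card_def, Finset.filter_val,
        eq_comm (a := b)] using this
    let σ : Equiv.Perm α := (Equiv.sigmaFiberEquiv f).symm.trans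
      ((Equiv.sigmaCongrRight fun b => Fintype.equivOfCardEq (hcard b)).trans
        (Equiv.sigmaFiberEquiv g))
    exact ⟨σ, fun a => (Fintype.equivOfCardEq (hcard (f a)) ⟨a, rfl⟩).2.symm⟩
  · rintro ⟨σ, hσ⟩
    calc (Finset.univ : Finset α).val.map f = (Finset.univ : Finset α).val.map (g ∘ σ) :=
          Multiset.map_congr rfl fun a _ => hσ a
      _ = (Finset.univ : Finset α).val.map g := by
          rw [← Multiset.map_map, Multiset.map_univ_val_equiv]

theorem count_map_univ_val {α β : Type*} [Fintype α] [DecidableEq β] (f : α → β) (b : β) :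
    (((Finset.univ : Finset α).val.map f).count b : ℝ) = ∑ a, if f a = b then 1 else 0 := by
  rw [Multiset.count_map, ← Finset.filter_val, Finset.card_val, Finset.natCast_card_filter]
  simp only [eq_comm]

theorem atp_eq_iff {v w : Fin k → Fin n} :
    atp k G v = atp k H w ↔
      (∀ i j, v i = v j ↔ w i = w j) ∧
        (∀ i j, G.graph.Adj (v i) (v j) ↔ H.graph.Adj (w i) (w j)) ∧
        ∀ i, G.col (v i) = H.col (w i) := by
  have key : ∀ p q : Prop, ∀ [Decidable p] [Decidable q],
      ((if p then (1 : ℝ) else 0) = if q then 1 else 0) ↔ (p ↔ q) := by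
    intro p q _ _
    by_cases hp : p <;> by_cases hq : q <;> simp [hp, hq]
  simp only [atp, Prod.mk.injEq, funext_iff, Subtype.forall, Prod.forall, key]
  refine and_congr ⟨fun h i j => ?_, fun h i j _ => h i j⟩
    (and_congr ⟨fun h i j => ?_, fun h i j _ => h i j⟩ Iff.rfl)
  · rcases lt_trichotomy i j with hij | rfl | hij
    · exact h i j hij
    · simp
    · rw [eq_comm, h j i hij, eq_comm]
  · rcases lt_trichotomy i j with hij | rfl | hij
    · exact h i j hij
    · simp
    · rw [SimpleGraph.adj_comm, h j i hij, SimpleGraph.adj_comm]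

theorem atp_comp_eq {m : ℕ} {v w : Fin k → Fin n} (h : atp k G v = atp k H w)
    (e : Fin m → Fin k) : atp m G (v ∘ e) = atp m H (w ∘ e) := by
  rw [atp_eq_iff] at h ⊢
  exact ⟨fun i j => h.1 _ _, fun i j => h.2.1 _ _, fun i => h.2.2 _⟩

theorem wl_succ_eq_iff {t : ℕ} {v w : Fin k → Fin n} :
    wl k (t + 1) G v = wl k (t + 1) H w ↔
      wl k t G v = wl k t H w ∧ ∃ σ : Equiv.Perm (Fin n), ∀ u,
        atp (k + 1) G (Fin.snoc (α := fun _ => Fin n) v u) =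
          atp (k + 1) H (Fin.snoc (α := fun _ => Fin n) w (σ u)) ∧
        ∀ i, wl k t G (Function.update v i u) = wl k t H (Function.update w i (σ u)) := by
  refine Prod.ext_iff.trans (and_congr Iff.rfl ?_)
  simp only [wl, map_univ_val_eq_iff, Prod.mk.injEq, funext_iff]

theorem wl_eq_of_le {s t : ℕ} (hst : s ≤ t) {v w : Fin k → Fin n}
    (h : wl k t G v = wl k t H w) : wl k s G v = wl k s H w := by
  induction hst with
  | refl => exact h
  | step _ ih => exact ih (wl_succ_eq_iff.1 h).1

/-- A self-map of a finite type misses a value outside of any given point. -/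
theorem exists_forall_ne_of_ne {α : Type*} [Finite α] (f : α → α) (i : α) :
    ∃ m, ∀ a, a ≠ i → f a ≠ m := by
  by_contra! hc
  choose g hgi hfg using hc
  have hg : Function.Injective g := fun a b hab => by rw [← hfg a, ← hfg b, hab]
  obtain ⟨a, ha⟩ := Finite.surjective_of_injective hg i
  exact hgi a ha

/-- `f` need not be injective. Overwriting position `i` of `v ∘ f` amounts to overwriting `v` at a
position `m` that `f` hits from no index other than `i`, then reindexing by a modified map; so the
induction must range over all `f`. -/
theorem wl_comp_eq {t : ℕ} {v w : Fin k → Fin n} (h : wl k t G v = wl k t H w)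
    (f : Fin k → Fin k) : wl k t G (v ∘ f) = wl k t H (w ∘ f) := by
  induction t generalizing v w f with
  | zero => exact atp_comp_eq h f
  | succ t ih =>
    rw [wl_succ_eq_iff] at h ⊢
    obtain ⟨h0, σ, hσ⟩ := h
    refine ⟨ih h0 f, σ, fun u => ⟨?_, fun i => ?_⟩⟩
    · have snoc_comp : ∀ (x : Fin k → Fin n) (y : Fin n),
          Fin.snoc (α := fun _ => Fin n) (x ∘ f) y =
            Fin.snoc (α := fun _ => Fin n) x y ∘
              Fin.snoc (α := fun _ => Fin (k + 1)) (Fin.castSucc ∘ f) (Fin.last k) := by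
        intro x y
        funext a
        refine Fin.lastCases ?_ (fun a => ?_) a <;> simp
      rw [snoc_comp, snoc_comp]
      exact atp_comp_eq (hσ u).1 _
    · obtain ⟨m, hm⟩ := exists_forall_ne_of_ne f i
      have update_comp : ∀ (x : Fin k → Fin n) (y : Fin n),
          Function.update (x ∘ f) i y = Function.update x m y ∘ Function.update f i m := by
        intro x y
        funext a
        by_cases ha : a = i
        · subst ha; simp
        · simp [ha, hm a ha]
      rw [update_comp, update_comp]
      exact ih ((hσ u).2 m) _

/-- Two `(k + 1)`-tuples are equivalent if their atomic types agree and `t` rounds of `k`-WL do not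
separate the `k`-tuples formed from their entries. -/
def WLEquiv (k t : ℕ) (G H : LabelledGraph n ℓ) (ν μ : Fin (k + 1) → Fin n) : Prop :=
  atp (k + 1) G ν = atp (k + 1) H μ ∧
    ∀ ι : Fin k → Fin (k + 1), wl k t G (ν ∘ ι) = wl k t H (μ ∘ ι)

/-- A `k`-tuple of entries that uses the new vertex involves at most `k - 1` positions of `v`, so
the new vertex can overwrite an unused one and the round `t` labels of the updates apply. A
`k`-tuple that avoids it is a reindexing of `v`. -/
theorem exists_perm_wlEquiv_insertNth {t : ℕ} {v w : Fin k → Fin n}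
    (h : wl k (t + 1) G v = wl k (t + 1) H w) :
    ∃ σ : Equiv.Perm (Fin n), ∀ u (j : Fin (k + 1)),
      WLEquiv k t G H (j.insertNth (α := fun _ => Fin n) u v)
        (j.insertNth (α := fun _ => Fin n) (σ u) w) := by
  rw [wl_succ_eq_iff] at h
  obtain ⟨h0, σ, hσ⟩ := h
  refine ⟨σ, fun u j => ⟨?_, fun ι => ?_⟩⟩
  · have insertNth_eq : ∀ (x : Fin k → Fin n) (y : Fin n),
        j.insertNth (α := fun _ => Fin n) y x = Fin.snoc (α := fun _ => Fin n) x y ∘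
          j.insertNth (α := fun _ => Fin (k + 1)) (Fin.last k) Fin.castSucc := by
      intro x y
      funext a
      rcases Fin.eq_self_or_eq_succAbove j a with rfl | ⟨b, rfl⟩ <;> simp
    rw [insertNth_eq, insertNth_eq]
    exact atp_comp_eq (hσ u).1 _
  · have hpre : ∀ a, ∃ b : Fin k, ι a ≠ j → ι a = j.succAbove b := by
      intro a
      rcases Fin.eq_self_or_eq_succAbove j (ι a) with h | ⟨b, hb⟩
      · exact ⟨a, fun h' => absurd h h'⟩
      · exact ⟨b, fun _ => hb⟩
    choose g hg using hpre
    by_cases hj : ∃ i, ι i = j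
    · obtain ⟨i, hi⟩ := hj
      obtain ⟨m, hm⟩ := exists_forall_ne_of_ne g i
      have insertNth_comp : ∀ (x : Fin k → Fin n) (y : Fin n),
          j.insertNth (α := fun _ => Fin n) y x ∘ ι =
            Function.update x m y ∘ fun a => if ι a = j then m else g a := by
        intro x y
        funext a
        by_cases ha : ι a = j
        · simp [ha]
        · have hai : a ≠ i := fun h => ha (h ▸ hi)
          rw [Function.comp_apply, Function.comp_apply, if_neg ha,
            Function.update_of_ne (hm a hai), hg a ha, Fin.insertNth_apply_succAbove]
      rw [insertNth_comp, insertNth_comp]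
      exact wl_comp_eq ((hσ u).2 m) _
    · push Not at hj
      have insertNth_comp : ∀ (x : Fin k → Fin n) (y : Fin n),
          j.insertNth (α := fun _ => Fin n) y x ∘ ι = x ∘ g := by
        intro x y
        funext a
        rw [Function.comp_apply, Function.comp_apply, hg a (hj a),
          Fin.insertNth_apply_succAbove]
      rw [insertNth_comp, insertNth_comp]
      exact wl_comp_eq h0 _

theorem WLEquiv.exists_perm_update {t : ℕ} {ν μ : Fin (k + 1) → Fin n}
    (h : WLEquiv k (t + 1) G H ν μ) (j : Fin (k + 1)) :
    ∃ σ : Equiv.Perm (Fin n), ∀ u,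
      WLEquiv k t G H (Function.update ν j u) (Function.update μ j (σ u)) := by
  obtain ⟨σ, hσ⟩ := exists_perm_wlEquiv_insertNth (h.2 j.succAbove)
  have update_eq : ∀ (x : Fin (k + 1) → Fin n) (y : Fin n), Function.update x j y =
      j.insertNth (α := fun _ => Fin n) y (x ∘ j.succAbove) := by
    intro x y
    funext a
    rcases Fin.eq_self_or_eq_succAbove j a with rfl | ⟨b, rfl⟩ <;> simp
  refine ⟨σ, fun u => ?_⟩
  rw [update_eq, update_eq]
  exact hσ u j

/-- The bijection supplied by `hperm` matches the two sums term by term, at the price of one round;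
every other construct is pointwise. -/
theorem eval_eq_of_forall_perm {Ω : FunCollection} {X : Type} [DecidableEq X]
    {R : ℕ → (X → Fin n) → (X → Fin n) → Prop} {T : ℕ}
    (heq : ∀ t ν μ, R t ν μ → ∀ x y, ν x = ν y ↔ μ x = μ y)
    (hadj : ∀ t ν μ, R t ν μ → ∀ x y, G.graph.Adj (ν x) (ν y) ↔ H.graph.Adj (μ x) (μ y))
    (hcol : ∀ t ν μ, R t ν μ → ∀ x, G.col (ν x) = H.col (μ x))
    (hperm : ∀ t ν μ, t < T → R (t + 1) ν μ → ∀ x, ∃ σ : Equiv.Perm (Fin n), ∀ u,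
      R t (Function.update ν x u) (Function.update μ x (σ u)))
    (φ : Expr ℓ Ω X) {t : ℕ} (hφ : φ.sd ≤ t) (ht : t ≤ T) {ν μ : X → Fin n} (h : R t ν μ) :
    φ.eval G ν = φ.eval H μ := by
  induction φ generalizing t ν μ with
  | eq x y => simp only [Expr.eval, heq t ν μ h x y]
  | ne x y => simp only [Expr.eval, ne_eq, heq t ν μ h x y]
  | edge x y =>
    classical
    exact if_congr (hadj t ν μ h x y) rfl rfl
  | lab s x => simp only [Expr.eval, hcol t ν μ h x]
  | mul φ ψ ih1 ih2 =>
    simp only [Expr.sd, max_le_iff] at hφ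
    simp only [Expr.eval, ih1 hφ.1 ht h, ih2 hφ.2 ht h]
  | add φ ψ ih1 ih2 =>
    simp only [Expr.sd, max_le_iff] at hφ
    simp only [Expr.eval, ih1 hφ.1 ht h, ih2 hφ.2 ht h]
  | smul a φ ih => simp only [Expr.eval, ih hφ ht h]
  | app f φ ih =>
    simp only [Expr.sd, Finset.sup_le_iff, Finset.mem_univ, true_imp_iff] at hφ
    simp only [Expr.eval, fun i => ih i (hφ i) ht h]
  | sum x φ ih =>
    obtain _ | t := t
    · simp [Expr.sd] at hφ
    · simp only [Expr.sd, add_le_add_iff_right] at hφ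
      obtain ⟨σ, hσ⟩ := hperm t ν μ ht h x
      simp only [Expr.eval]
      rw [← Equiv.sum_comp σ fun u => φ.eval H (Function.update μ x u)]
      exact Finset.sum_congr rfl fun u _ => ih hφ (Nat.le_of_succ_le ht) (hσ u)

theorem WLEquiv.eval_eq {Ω : FunCollection} {t : ℕ} {ν μ : Fin (k + 1) → Fin n}
    (h : WLEquiv k t G H ν μ) (φ : Expr ℓ Ω (Fin (k + 1))) (hφ : φ.sd ≤ t) :
    φ.eval G ν = φ.eval H μ :=
  eval_eq_of_forall_perm (R := fun t => WLEquiv k t G H) (T := t)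
    (fun _ _ _ h => (atp_eq_iff.1 h.1).1) (fun _ _ _ h => (atp_eq_iff.1 h.1).2.1)
    (fun _ _ _ h => (atp_eq_iff.1 h.1).2.2) (fun _ _ _ _ h x => h.exists_perm_update x)
    φ hφ le_rfl h

theorem gwlStable_eq_iff_exists_perm :
    gwlStable k G = gwlStable k H ↔
      ∃ σ : Equiv.Perm (Fin k → Fin n), ∀ v t, wl k t G v = wl k t H (σ v) := by
  simp only [gwlStable, map_univ_val_eq_iff, wlStable, funext_iff]

theorem gwl_eq_iff_exists_perm {t : ℕ} :
    gwl k t G = gwl k t H ↔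
      ∃ σ : Equiv.Perm (Fin k → Fin n), ∀ v, wl k t G v = wl k t H (σ v) := by
  simp only [gwl, map_univ_val_eq_iff]

theorem gwlStable_eq_of_forall_gwl_eq (h : ∀ t, gwl k t G = gwl k t H) :
    gwlStable k G = gwlStable k H := by
  rw [gwlStable_eq_iff_exists_perm]
  by_contra! hc
  choose v t hvt using hc
  -- There are finitely many permutations, each failing at some round; take the largest of these
  -- rounds.
  obtain ⟨σ, hσ⟩ := gwl_eq_iff_exists_perm.1 (h (Finset.univ.sup t))
  exact hvt σ (wl_eq_of_le (Finset.le_sup (Finset.mem_univ σ)) (hσ (v σ)))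

end WeisfeilerLeman

/-! ### Colour refinement and two-variable expressions -/

section ColorRefinement

variable {n ℓ : ℕ} {G H : LabelledGraph n ℓ}

theorem cr_eq_of_le {s t : ℕ} (hst : s ≤ t) {v w : Fin n} (h : cr t G v = cr t H w) :
    cr s G v = cr s H w := by
  induction hst with
  | refl => exact h
  | step _ ih => exact ih (Prod.ext_iff.1 h).1

theorem gcr_eq_iff_exists_perm {t : ℕ} :
    gcr t G = gcr t H ↔ ∃ σ : Equiv.Perm (Fin n), ∀ v, cr t G v = cr t H (σ v) := by
  simp only [gcr, map_univ_val_eq_iff]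

theorem gcr_eq_of_le {s t : ℕ} (hst : s ≤ t) (h : gcr t G = gcr t H) : gcr s G = gcr s H := by
  rw [gcr_eq_iff_exists_perm] at h ⊢
  exact h.imp fun σ hσ v => cr_eq_of_le hst (hσ v)

open Classical in
/-- The vertices split into a vertex `v`, its neighbours, and the others. -/
theorem univ_val_eq_add (G : LabelledGraph n ℓ) (v : Fin n) :
    (Finset.univ : Finset (Fin n)).val = {v} + (G.graph.neighborFinset v).val +
      ((Finset.univ.erase v).filter fun u => ¬G.graph.Adj v u).val := by
  have h1 : G.graph.neighborFinset v = (Finset.univ.erase v).filter fun u => G.graph.Adj v u := by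
    ext u
    simp only [SimpleGraph.mem_neighborFinset, Finset.mem_filter, Finset.mem_erase,
      Finset.mem_univ, and_true]
    exact ⟨fun h => ⟨h.ne', h⟩, fun h => h.2⟩
  rw [h1, add_assoc, Finset.filter_val, Finset.filter_val, Multiset.filter_add_not,
    Finset.erase_val, Multiset.singleton_add, Multiset.cons_erase (Finset.mem_univ_val v)]

-- Round `t + 1` labels match only the neighbours. Cancelling these and the vertex itself from `gcr
-- t` matches the remaining vertices too.
open Classical in
theorem exists_perm_of_cr_succ_eq {t : ℕ} (hg : gcr t G = gcr t H) {v w : Fin n}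
    (h : cr (t + 1) G v = cr (t + 1) H w) :
    ∃ σ : Equiv.Perm (Fin n), ∀ u, (v = u ↔ w = σ u) ∧
      (G.graph.Adj v u ↔ H.graph.Adj w (σ u)) ∧ cr t G u = cr t H (σ u) := by
  obtain ⟨h0, hN⟩ := Prod.ext_iff.1 h
  change cr t G v = cr t H w at h0
  change (G.graph.neighborFinset v).val.map (cr t G) =
    (H.graph.neighborFinset w).val.map (cr t H) at hN
  have gcr_eq : ∀ (K : LabelledGraph n ℓ) (x : Fin n), gcr t K =
      {cr t K x} + (K.graph.neighborFinset x).val.map (cr t K) +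
        ((Finset.univ.erase x).filter fun u => ¬K.graph.Adj x u).val.map (cr t K) := by
    intro K x
    rw [gcr, univ_val_eq_add K x, Multiset.map_add, Multiset.map_add, Multiset.map_singleton]
  rw [gcr_eq G v, gcr_eq H w, hN, h0, add_right_inj] at hg
  have key : (Finset.univ : Finset (Fin n)).val.map
        (fun u => ((v = u : Prop), (G.graph.Adj v u : Prop), cr t G u)) =
      (Finset.univ : Finset (Fin n)).val.map
        (fun u => ((w = u : Prop), (H.graph.Adj w u : Prop), cr t H u)) := by
    have split : ∀ (K : LabelledGraph n ℓ) (x : Fin n),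
        (Finset.univ : Finset (Fin n)).val.map
          (fun u => ((x = u : Prop), (K.graph.Adj x u : Prop), cr t K u)) =
        {(True, False, cr t K x)} +
          ((K.graph.neighborFinset x).val.map (cr t K)).map (fun c => (False, True, c)) +
          (((Finset.univ.erase x).filter fun u => ¬K.graph.Adj x u).val.map (cr t K)).map
            (fun c => (False, False, c)) := by
      intro K x
      rw [univ_val_eq_add K x, Multiset.map_add, Multiset.map_add, Multiset.map_map,
        Multiset.map_map]
      congr 1
      · congr 1
        · simp
        · refine Multiset.map_congr rfl fun u hu => ?_
          have hu' : K.graph.Adj x u := by simpa using hu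
          simp [hu', hu'.ne]
      · refine Multiset.map_congr rfl fun u hu => ?_
        have hu' : u ≠ x ∧ ¬K.graph.Adj x u := by
          simpa only [Finset.mem_val, Finset.mem_filter, Finset.mem_erase, Finset.mem_univ,
            and_true] using hu
        simp [hu'.2, hu'.1.symm]
    rw [split, split, hN, hg, h0]
  obtain ⟨σ, hσ⟩ := map_univ_val_eq_iff.1 key
  refine ⟨σ, fun u => ?_⟩
  have := hσ u
  simp only [Prod.mk.injEq, eq_iff_iff] at this
  exact this

/-- Two pairs are equivalent if their atomic types agree and `t` rounds of color refinement do not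
separate their entries. -/
def CREquiv (t : ℕ) (G H : LabelledGraph n ℓ) (ν μ : Fin 2 → Fin n) : Prop :=
  atp 2 G ν = atp 2 H μ ∧ ∀ x, cr t G (ν x) = cr t H (μ x)

theorem cr_eq_col {t : ℕ} {v w : Fin n} (h : cr t G v = cr t H w) : G.col v = H.col w :=
  cr_eq_of_le (Nat.zero_le t) h

theorem CREquiv.exists_perm_update {t : ℕ} (hg : gcr t G = gcr t H) {ν μ : Fin 2 → Fin n}
    (h : CREquiv (t + 1) G H ν μ) (x : Fin 2) :
    ∃ σ : Equiv.Perm (Fin n), ∀ u,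
      CREquiv t G H (Function.update ν x u) (Function.update μ x (σ u)) := by
  have aux : ∀ y, y ≠ x → ∃ σ : Equiv.Perm (Fin n), ∀ u,
      CREquiv t G H (Function.update ν x u) (Function.update μ x (σ u)) := by
    intro y hy
    have hxy : ∀ z : Fin 2, z = x ∨ z = y := by omega
    obtain ⟨σ, hσ⟩ := exists_perm_of_cr_succ_eq hg (h.2 y)
    have hcr : ∀ u z, cr t G (Function.update ν x u z) = cr t H (Function.update μ x (σ u) z) := by
      intro u z
      rcases hxy z with rfl | rfl
      · simpa using (hσ u).2.2
      · simpa [hy] using cr_eq_of_le (Nat.le_succ t) (h.2 z)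
    refine ⟨σ, fun u => ⟨atp_eq_iff.2 ⟨fun i j => ?_, fun i j => ?_, fun i => ?_⟩, hcr u⟩⟩
    · rcases hxy i with rfl | rfl <;> rcases hxy j with rfl | rfl
      · simp
      · simpa [hy, eq_comm] using (hσ u).1
      · simpa [hy] using (hσ u).1
      · simp
    · rcases hxy i with rfl | rfl <;> rcases hxy j with rfl | rfl
      · simp
      · simpa [hy, SimpleGraph.adj_comm] using (hσ u).2.1
      · simpa [hy] using (hσ u).2.1
      · simp
    · exact cr_eq_col (hcr u i)
  -- In `Fin 2`, `x + 1` is the position other than `x`, which stays fixed.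
  exact aux (x + 1) (by fin_cases x <;> decide)

theorem CREquiv.eval_eq {Ω : FunCollection} {t : ℕ} (hg : gcr t G = gcr t H)
    {ν μ : Fin 2 → Fin n} (h : CREquiv t G H ν μ) (φ : Expr ℓ Ω (Fin 2)) (hφ : φ.sd ≤ t) :
    φ.eval G ν = φ.eval H μ :=
  eval_eq_of_forall_perm (R := fun t => CREquiv t G H) (T := t)
    (fun _ _ _ h => (atp_eq_iff.1 h.1).1) (fun _ _ _ h => (atp_eq_iff.1 h.1).2.1)
    (fun _ _ _ h => (atp_eq_iff.1 h.1).2.2)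
    (fun _ _ _ ht h x => h.exists_perm_update (gcr_eq_of_le ht.le hg) x) φ hφ le_rfl h

theorem Expr.eval_congr {Ω : FunCollection} {X : Type} [DecidableEq X] (G : LabelledGraph n ℓ)
    (φ : Expr ℓ Ω X) {ν μ : X → Fin n} (h : ∀ x ∈ φ.free, ν x = μ x) :
    φ.eval G ν = φ.eval G μ := by
  induction φ generalizing ν μ with
  | eq x y => simp only [Expr.eval, h x (by simp [Expr.free]), h y (by simp [Expr.free])]
  | ne x y => simp only [Expr.eval, h x (by simp [Expr.free]), h y (by simp [Expr.free])]
  | edge x y =>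
    classical
    refine if_congr ?_ rfl rfl
    rw [h x (by simp [Expr.free]), h y (by simp [Expr.free])]
  | lab s x => simp only [Expr.eval, h x (by simp [Expr.free])]
  | mul φ ψ ih1 ih2 =>
    simp only [Expr.eval, ih1 fun x hx => h x (Or.inl hx), ih2 fun x hx => h x (Or.inr hx)]
  | add φ ψ ih1 ih2 =>
    simp only [Expr.eval, ih1 fun x hx => h x (Or.inl hx), ih2 fun x hx => h x (Or.inr hx)]
  | smul a φ ih => simp only [Expr.eval, ih h]
  | app f φ ih =>
    simp only [Expr.eval, fun i => ih i fun x hx => h x (Set.mem_iUnion.2 ⟨i, hx⟩)]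
  | sum x φ ih =>
    refine Finset.sum_congr rfl fun u _ => ih fun y hy => ?_
    by_cases hyx : y = x
    · subst hyx; simp
    · simpa [hyx] using h y ⟨hy, hyx⟩

/-- The extra level of depth is paid by `gcr` itself: the body of an outermost sum has no free
variable but the summed one, so it may be evaluated on constant valuations, which the bijection from
`gcr t` matches. -/
theorem eval_eq_of_gcr_eq {Ω : FunCollection} {t : ℕ} (hg : gcr t G = gcr t H)
    (φ : Expr ℓ Ω (Fin 2)) (hφ : φ.sd ≤ t + 1) (hfree : φ.free = ∅) (ν μ : Fin 2 → Fin n) :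
    φ.eval G ν = φ.eval H μ := by
  induction φ with
  | eq x y => exact absurd hfree (Set.insert_nonempty _ _).ne_empty
  | ne x y => exact absurd hfree (Set.insert_nonempty _ _).ne_empty
  | edge x y => exact absurd hfree (Set.insert_nonempty _ _).ne_empty
  | lab s x => simp [Expr.free] at hfree
  | mul φ ψ ih1 ih2 =>
    simp only [Expr.sd, max_le_iff] at hφ
    simp only [Expr.free, Set.union_empty_iff] at hfree
    simp only [Expr.eval, ih1 hφ.1 hfree.1, ih2 hφ.2 hfree.2]
  | add φ ψ ih1 ih2 =>
    simp only [Expr.sd, max_le_iff] at hφ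
    simp only [Expr.free, Set.union_empty_iff] at hfree
    simp only [Expr.eval, ih1 hφ.1 hfree.1, ih2 hφ.2 hfree.2]
  | smul a φ ih => simp only [Expr.eval, ih hφ hfree]
  | app f φ ih =>
    simp only [Expr.sd, Finset.sup_le_iff, Finset.mem_univ, true_imp_iff] at hφ
    simp only [Expr.free, Set.iUnion_eq_empty] at hfree
    simp only [Expr.eval, fun i => ih i (hφ i) (hfree i)]
  | sum x φ _ =>
    simp only [Expr.sd, add_le_add_iff_right] at hφ
    simp only [Expr.free, Set.sdiff_eq_empty] at hfree
    obtain ⟨σ, hσ⟩ := gcr_eq_iff_exists_perm.1 hg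
    have heval : ∀ (K : LabelledGraph n ℓ) (κ : Fin 2 → Fin n) (u : Fin n),
        φ.eval K (Function.update κ x u) = φ.eval K fun _ => u := by
      intro K κ u
      refine φ.eval_congr K fun y hy => ?_
      rw [Set.mem_singleton_iff.1 (hfree hy), Function.update_self]
    simp only [Expr.eval, heval]
    rw [← Equiv.sum_comp σ fun u => φ.eval H fun _ => u]
    refine Finset.sum_congr rfl fun u _ => CREquiv.eval_eq hg ⟨atp_eq_iff.2 ?_, fun _ => hσ u⟩ φ hφ
    exact ⟨by simp, by simp, fun _ => cr_eq_col (hσ u)⟩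

open Classical in
/-- The color refinement label encoded by a `1`-WL label. -/
noncomputable def crOfWL : (t : ℕ) → WLLabel 1 ℓ t → CRLabel ℓ t
  | 0, a => a.2.2 0
  | t + 1, a => (crOfWL t a.1,
      (a.2.filter fun b => b.1.2.1 ⟨(0, 1), Nat.zero_lt_one⟩ = 1).map fun b => crOfWL t (b.2 0))

/-- For `k = 1` the update by `u` is `u` itself, and the atomic type of the pair tells which `u` are
neighbours. -/
theorem crOfWL_wl (t : ℕ) (G : LabelledGraph n ℓ) (v : Fin 1 → Fin n) :
    crOfWL t (wl 1 t G v) = cr t G (v 0) := by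
  classical
  induction t generalizing v with
  | zero => rfl
  | succ t ih =>
    refine Prod.ext (ih v) ?_
    rw [crOfWL, cr, wl]
    dsimp only
    rw [Multiset.filter_map, Multiset.map_map]
    refine Multiset.map_congr ?_ fun u _ => ?_
    · rw [SimpleGraph.neighborFinset_eq_filter, Finset.filter_val]
      refine Multiset.filter_congr fun u _ => ?_
      simp [atp, Fin.snoc]
    · simp [ih]

theorem gcr_eq_of_gwl_one_eq {t : ℕ} (h : gwl 1 t G = gwl 1 t H) : gcr t G = gcr t H := by
  have key : ∀ K : LabelledGraph n ℓ, gcr t K = (gwl 1 t K).map (crOfWL t) := by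
    intro K
    simp only [gwl, gcr, Multiset.map_map, Function.comp_def, crOfWL_wl]
    rw [← Finset.map_univ_equiv (Equiv.funUnique (Fin 1) (Fin n)).symm, Finset.map_val,
      Multiset.map_map]
    rfl
  rw [key, key, h]

end ColorRefinement

/-! ### Defining labels by expressions on a family of graphs -/

section Definability

variable {n ℓ : ℕ} {I X : Type} [DecidableEq X]

/-- The functions of a member of the family `𝓖` and of a valuation that are given by an expression
of summation depth at most `t` with free variables in `S`. -/
def Definable (Ω : FunCollection) (𝓖 : I → LabelledGraph n ℓ) (S : Set X) (t : ℕ)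
    (F : I × (X → Fin n) → ℝ) : Prop :=
  ∃ φ : Expr ℓ Ω X, φ.free ⊆ S ∧ φ.sd ≤ t ∧ ∀ p, F p = φ.eval (𝓖 p.1) p.2

variable {Ω : FunCollection} {𝓖 : I → LabelledGraph n ℓ} {S S' : Set X} {t t' : ℕ}
  {F : I × (X → Fin n) → ℝ}

theorem Definable.mono (h : Definable Ω 𝓖 S t F) (hS : S ⊆ S') (ht : t ≤ t') :
    Definable Ω 𝓖 S' t' F := by
  obtain ⟨φ, h1, h2, h3⟩ := h
  exact ⟨φ, h1.trans hS, h2.trans ht, h3⟩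

theorem Definable.sum (h : Definable Ω 𝓖 S t F) (x : X) :
    Definable Ω 𝓖 (S \ {x}) (t + 1) fun p => ∑ u, F (p.1, Function.update p.2 x u) := by
  obtain ⟨φ, h1, h2, h3⟩ := h
  exact ⟨.sum x φ, Set.sdiff_subset_sdiff_left h1, Nat.succ_le_succ h2, fun p => by
    simp only [Expr.eval, h3]⟩

/-- Definable functions form an algebra as soon as there is an admissible free variable. -/
def definableSubalgebra (Ω : FunCollection) (𝓖 : I → LabelledGraph n ℓ) (S : Set X) (t : ℕ)
    (hS : S.Nonempty) : Subalgebra ℝ (I × (X → Fin n) → ℝ) where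
  carrier := {F | Definable Ω 𝓖 S t F}
  mul_mem' := by
    rintro F F' ⟨φ, h1, h2, h3⟩ ⟨φ', h1', h2', h3'⟩
    exact ⟨.mul φ φ', Set.union_subset h1 h1', max_le h2 h2', fun p => by
      simp only [Pi.mul_apply, Expr.eval, h3, h3']⟩
  add_mem' := by
    rintro F F' ⟨φ, h1, h2, h3⟩ ⟨φ', h1', h2', h3'⟩
    exact ⟨.add φ φ', Set.union_subset h1 h1', max_le h2 h2', fun p => by
      simp only [Pi.add_apply, Expr.eval, h3, h3']⟩
  algebraMap_mem' := by
    intro a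
    obtain ⟨x, hx⟩ := hS
    -- A constant has to be written with some variable, hence the nonemptiness of `S`.
    exact ⟨.smul a (.eq x x), by simpa [Expr.free] using hx, Nat.zero_le t, fun p => by
      simp [Expr.eval, Pi.algebraMap_apply]⟩

/-- A finite Stone-Weierstrass theorem: an algebra of functions on a finite type contains all
functions of a label, if its functions of the label separate labels. -/
theorem comp_mem_of_separates {P L : Type*} [Finite P] (A : Subalgebra ℝ (P → ℝ)) (lab : P → L)
    (hsep : ∀ c d, c ≠ d → ∃ f : L → ℝ, f ∘ lab ∈ A ∧ f c ≠ f d) (g : L → ℝ) :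
    g ∘ lab ∈ A := by
  classical
  have := Fintype.ofFinite P
  let s : Finset L := Finset.univ.image lab
  -- Lagrange interpolation: a product of normalised differences is the indicator of `c` on the
  -- finitely many labels that occur.
  have hind : ∀ c, ∃ f : L → ℝ, f ∘ lab ∈ A ∧ ∀ d ∈ s, f d = if d = c then 1 else 0 := by
    intro c
    have hsep' : ∀ d, ∃ f : L → ℝ, f ∘ lab ∈ A ∧ f c = 1 ∧ (d ≠ c → f d = 0) := by
      intro d
      by_cases hd : d = c
      · exact ⟨1, A.one_mem, rfl, fun h => absurd hd h⟩
      · obtain ⟨f, hf, hfd⟩ := hsep c d (Ne.symm hd)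
        refine ⟨fun l => (f c - f d)⁻¹ * (f l - f d), ?_, ?_, fun _ => by simp⟩
        · exact A.smul_mem (A.sub_mem hf (A.algebraMap_mem (f d))) (f c - f d)⁻¹
        · exact inv_mul_cancel₀ (sub_ne_zero.2 hfd)
    choose f hfA hfc hfd using hsep'
    refine ⟨fun l => ∏ d ∈ s, f d l, ?_, fun d hd => ?_⟩
    · have : (fun l => ∏ d ∈ s, f d l) ∘ lab = ∏ d ∈ s, f d ∘ lab := by
        funext p
        simp
      rw [this]
      exact A.prod_mem fun d _ => hfA d
    · split_ifs with h
      · subst h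
        exact Finset.prod_eq_one fun d' _ => hfc d'
      · exact Finset.prod_eq_zero hd (hfd d h)
  choose f hfA hf using hind
  have hg : g ∘ lab = ∑ c ∈ s, g c • (f c ∘ lab) := by
    funext p
    have hp : lab p ∈ s := Finset.mem_image_of_mem _ (Finset.mem_univ p)
    simp [hf _ _ hp, hp]
  rw [hg]
  exact A.sum_mem fun c _ => A.smul_mem (hfA c) _

theorem definable_atp [Finite I] [Finite X] {k : ℕ} (hk : 1 ≤ k) (ι : Fin k → X)
    (g : AtomicType k ℓ → ℝ) :
    Definable Ω 𝓖 (Set.range ι) 0 fun p => g (atp k (𝓖 p.1) (p.2 ∘ ι)) := by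
  have hS : (Set.range ι).Nonempty := ⟨ι ⟨0, hk⟩, Set.mem_range_self _⟩
  refine comp_mem_of_separates (definableSubalgebra Ω 𝓖 (Set.range ι) 0 hS)
    (fun p : I × (X → Fin n) => atp k (𝓖 p.1) (p.2 ∘ ι)) (fun c d hcd => ?_) g
  -- `hc` says that no definable function of the label separates `c` from `d`; each coordinate is
  -- such a function.
  by_contra! hc
  refine hcd (Prod.ext ?_ (Prod.ext ?_ ?_))
  · funext q
    refine hc (fun a => a.1 q) ⟨.eq (ι q.1.1) (ι q.1.2), ?_, le_rfl, fun p => ?_⟩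
    · simp [Expr.free, Set.insert_subset_iff]
    · simp [Expr.eval, atp]
  · funext q
    refine hc (fun a => a.2.1 q) ⟨.edge (ι q.1.1) (ι q.1.2), ?_, le_rfl, fun p => ?_⟩
    · simp [Expr.free, Set.insert_subset_iff]
    · simp [Expr.eval, atp]
  · funext i s
    refine hc (fun a => a.2.2 i s) ⟨.lab s (ι i), ?_, le_rfl, fun p => ?_⟩
    · simp [Expr.free]
    · simp [Expr.eval, atp]

theorem exists_notMem_range {k : ℕ} (ι : Fin k → Fin (k + 1)) : ∃ y, ∀ i, ι i ≠ y := by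
  by_contra! hc
  have := Fintype.card_le_of_surjective ι hc
  simp at this

theorem definable_wl [Finite I] {k : ℕ} (hk : 1 ≤ k) (t : ℕ) (ι : Fin k → Fin (k + 1))
    (g : WLLabel k ℓ t → ℝ) :
    Definable Ω 𝓖 (Set.range ι) t fun p => g (wl k t (𝓖 p.1) (p.2 ∘ ι)) := by
  classical
  induction t generalizing ι with
  | zero => exact definable_atp hk ι g
  | succ t ih =>
    have hS : (Set.range ι).Nonempty := ⟨ι ⟨0, hk⟩, Set.mem_range_self _⟩
    refine comp_mem_of_separates (definableSubalgebra Ω 𝓖 (Set.range ι) (t + 1) hS)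
      (fun p : I × (Fin (k + 1) → Fin n) => wl k (t + 1) (𝓖 p.1) (p.2 ∘ ι)) (fun c d hcd => ?_) g
    by_contra! hc
    refine hcd (Prod.ext ?_ (Multiset.ext.2 fun m => ?_))
    · by_contra hne
      have := hc (fun a => if a.1 = c.1 then 1 else 0) <|
        (ih ι fun b => if b = c.1 then 1 else 0).mono subset_rfl (Nat.le_succ t)
      simp [Ne.symm hne] at this
    · have hcount : Definable Ω 𝓖 (Set.range ι) (t + 1) fun p =>
          ((wl k (t + 1) (𝓖 p.1) (p.2 ∘ ι)).2.count m : ℝ) := by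
        -- `ι` occupies at most `k` of the `k + 1` variables; the spare `y` ranges over the vertices
        -- `u` of the refinement step.
        obtain ⟨y, hy⟩ := exists_notMem_range ι
        have hT : (insert y (Set.range ι)).Nonempty := ⟨y, Set.mem_insert _ _⟩
        have hatp : Definable Ω 𝓖 (insert y (Set.range ι)) t fun p =>
            if atp (k + 1) (𝓖 p.1) (p.2 ∘ Fin.snoc (α := fun _ => Fin (k + 1)) ι y) = m.1
              then 1 else 0 := by
          refine (definable_atp (Nat.le_add_left 1 k) _ fun a => if a = m.1 then 1 else 0).mono
            ?_ (Nat.zero_le t)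
          rintro _ ⟨a, rfl⟩
          refine Fin.lastCases ?_ (fun a => ?_) a <;> simp
        have hwl : ∀ i, Definable Ω 𝓖 (insert y (Set.range ι)) t fun p =>
            if wl k t (𝓖 p.1) (p.2 ∘ Function.update ι i y) = m.2 i then 1 else 0 := by
          intro i
          refine (ih (Function.update ι i y) fun a => if a = m.2 i then 1 else 0).mono ?_ le_rfl
          rintro _ ⟨a, rfl⟩
          by_cases ha : a = i
          · subst ha; simp
          · simp [ha]
        have hmul := (definableSubalgebra Ω 𝓖 (insert y (Set.range ι)) t hT).mul_mem hatp
          (Subalgebra.prod_mem _ fun i (_ : i ∈ Finset.univ) => hwl i)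
        have hsum := (Definable.sum hmul y).mono (S' := Set.range ι) (by simp) le_rfl
        convert hsum using 2 with p
        have hsnoc : ∀ u, Function.update p.2 y u ∘ Fin.snoc (α := fun _ => Fin (k + 1)) ι y =
            Fin.snoc (α := fun _ => Fin n) (p.2 ∘ ι) u := by
          intro u
          funext a
          refine Fin.lastCases ?_ (fun a => ?_) a <;> simp [hy]
        have hupd : ∀ u i, Function.update p.2 y u ∘ Function.update ι i y =
            Function.update (p.2 ∘ ι) i u := by
          intro u i
          funext a
          by_cases ha : a = i
          · subst ha; simp
          · simp [ha, hy]
        refine (count_map_univ_val (α := Fin n) _ m).trans (Finset.sum_congr rfl fun u _ => ?_)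
        simp only [Pi.mul_apply, Finset.prod_apply, hsnoc, hupd, Finset.prod_boole,
          ite_mul, one_mul, zero_mul, ← ite_and]
        congr 1
        rw [eq_iff_iff, Prod.ext_iff, funext_iff]
        simp
      exact_mod_cast hc (fun a => (a.2.count m : ℝ)) hcount

/-- The variables are summed out one at a time, each costing one level; injectivity of `ι` keeps the
other entries unchanged. -/
theorem Definable.sum_tuple {k : ℕ} {ι : Fin k → X} (hι : Function.Injective ι) {t : ℕ}
    {F : I → (Fin k → Fin n) → ℝ}
    (h : Definable Ω 𝓖 (Set.range ι) t fun p => F p.1 (p.2 ∘ ι)) :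
    Definable Ω 𝓖 (∅ : Set X) (t + k) fun p => ∑ v, F p.1 v := by
  induction k generalizing t with
  | zero =>
    refine Eq.mp ?_ (h.mono (S' := ∅) (by simp) le_rfl)
    congr 1
    funext p
    rw [Fintype.sum_unique]
    congr 1
    exact Subsingleton.elim _ _
  | succ k ih =>
    have hstep : Definable Ω 𝓖 (Set.range (ι ∘ Fin.succ)) (t + 1) fun p =>
        ∑ u, F p.1 (Fin.cons (α := fun _ => Fin n) u (p.2 ∘ (ι ∘ Fin.succ))) := by
      have hsum := (h.sum (ι 0)).mono (S' := Set.range (ι ∘ Fin.succ)) (by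
        rintro _ ⟨⟨a, rfl⟩, ha⟩
        refine Fin.cases (fun ha => absurd rfl ha) (fun a _ => ⟨a, rfl⟩) a ha) le_rfl
      convert hsum using 4 with p u
      funext a
      refine Fin.cases ?_ (fun a => ?_) a
      · simp
      · simp [hι.eq_iff]
    have := ih (hι.comp (Fin.succ_injective k))
      (F := fun i v => ∑ u, F i (Fin.cons (α := fun _ => Fin n) u v)) hstep
    rw [add_assoc, add_comm 1 k] at this
    convert this using 2 with p
    rw [← (Fin.consEquiv fun _ => Fin n).sum_comp, Fintype.sum_prod_type, Finset.sum_comm]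
    rfl

end Definability

/-! ### From expressions to graph labels and back -/

section Separation

variable {n ℓ k : ℕ} {Ω : FunCollection} {G H : LabelledGraph n ℓ}

theorem gwl_eq_of_eval_eq (hk : 1 ≤ k) (t : ℕ)
    (h : ∀ φ : Expr ℓ Ω (Fin (k + 1)), φ.sd ≤ t + k → φ.free = ∅ → ∀ ν, φ.eval G ν = φ.eval H ν) :
    gwl k t G = gwl k t H := by
  classical
  refine Multiset.ext.2 fun c => ?_
  obtain hn | ⟨⟨u⟩⟩ := isEmpty_or_nonempty (Fin n)
  · have : Nonempty (Fin k) := ⟨⟨0, hk⟩⟩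
    -- Since `k ≥ 1`, the empty graph has no `k`-tuples.
    simp [gwl]
  -- Indexing `G` and `H` by `Bool` yields one expression that counts `c` in both.
  · obtain ⟨φ, hfree, hsd, hφ⟩ := (definable_wl (Ω := Ω) (𝓖 := fun b => cond b G H) hk t Fin.castSucc
      fun a => if a = c then 1 else 0).sum_tuple
        (F := fun b v => if wl k t (cond b G H) v = c then 1 else 0) (Fin.castSucc_injective k)
    have hcount : ∀ K : LabelledGraph n ℓ,
        ((gwl k t K).count c : ℝ) = ∑ v, if wl k t K v = c then 1 else 0 :=
      fun K => count_map_univ_val _ c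
    have hG := hφ (true, fun _ => u)
    have hH := hφ (false, fun _ => u)
    simp only [cond_true, cond_false, ← hcount] at hG hH
    rw [← h φ hsd (Set.subset_empty_iff.1 hfree), ← hG] at hH
    exact_mod_cast hH.symm

theorem mem_rho0_singleton {β : Type} (f : LabelledGraph n ℓ → β) :
    (G, H) ∈ rho0 {⟨β, f⟩} ↔ f G = f H := by
  simp [rho0]

theorem mem_rho0_graphFuns {X : Type} [DecidableEq X] {L : Set (Expr ℓ Ω X)} :
    (G, H) ∈ rho0 (graphFuns n L) ↔
      ∀ φ ∈ L, φ.free = ∅ → ∀ ν, φ.eval G ν = φ.eval H ν := by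
  constructor
  · intro h φ hφ hfree ν
    have := h ⟨Fin 1 → ℝ, fun K _ => φ.eval K ν⟩ ⟨1, _, ⟨fun _ => φ, fun _ => ⟨hφ, hfree⟩,
      fun K μ => funext fun _ => φ.eval_congr K (by simp [hfree])⟩, rfl⟩
    exact congrFun this 0
  · rintro h _ ⟨d, f, ⟨φ, hφ, hf⟩, rfl⟩
    obtain hν | ⟨⟨ν⟩⟩ := isEmpty_or_nonempty (X → Fin n)
    -- Without valuations, representation puts no constraint on `f`; but then there are no vertices
    -- and only one graph.
    · have : IsEmpty (Fin n) := ⟨fun u => hν.elim fun _ => u⟩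
      have hGH : G = H := by
        cases G
        cases H
        congr 1
        · ext u
          exact isEmptyElim u
        · exact Subsingleton.elim _ _
      rw [hGH]
    · change f G = f H
      rw [hf G ν, hf H ν]
      exact funext fun j => h _ (hφ j).1 (hφ j).2 ν

theorem eval_eq_of_gwlStable_eq (h : gwlStable k G = gwlStable k H) (φ : Expr ℓ Ω (Fin (k + 1)))
    (hfree : φ.free = ∅) (ν : Fin (k + 1) → Fin n) : φ.eval G ν = φ.eval H ν := by
  obtain ⟨σ, hσ⟩ := gwlStable_eq_iff_exists_perm.1 h
  -- A closed expression ignores the valuation, so any related pair will do: start at a constant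
  -- tuple and insert one more vertex, which uses up the additional round.
  obtain ⟨τ, hτ⟩ := exists_perm_wlEquiv_insertNth (hσ (fun _ => ν 0) (φ.sd + 1))
  rw [φ.eval_congr G fun x hx => by simp [hfree] at hx, (hτ (ν 0) 0).eval_eq φ le_rfl]
  exact φ.eval_congr H fun x hx => by simp [hfree] at hx

end Separation

end TensorLang

theorem theorem4 (n ℓ t k : ℕ) (hk : 1 ≤ k) (Ω : TensorLang.FunCollection) :
    (TensorLang.rho0 (n := n) (ℓ := ℓ) {⟨_, TensorLang.gcr t⟩} =
        TensorLang.rho0 (TensorLang.graphFuns n (TensorLang.TLDepth ℓ 2 (t + 1) Ω)) ∧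
      TensorLang.rho0 (TensorLang.graphFuns n (TensorLang.TLDepth ℓ 2 (t + 1) Ω)) =
        TensorLang.rho0 (n := n) (ℓ := ℓ) {⟨_, TensorLang.gwl 1 t⟩}) ∧
    TensorLang.rho0 (n := n) (ℓ := ℓ) {⟨_, TensorLang.gwlStable k⟩} =
      TensorLang.rho0 (TensorLang.graphFuns n (TensorLang.TL ℓ (k + 1) Ω)) := by
  open TensorLang in
  have crTL : rho0 (n := n) (ℓ := ℓ) {⟨_, gcr t⟩} ⊆ rho0 (graphFuns n (TLDepth ℓ 2 (t + 1) Ω)) := by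
    rintro ⟨G, H⟩ h
    exact mem_rho0_graphFuns.2 fun φ hφ hfree ν =>
      eval_eq_of_gcr_eq ((mem_rho0_singleton _).1 h) φ hφ.2 hfree ν ν
  have TLwl : rho0 (graphFuns n (TLDepth ℓ 2 (t + 1) Ω)) ⊆ rho0 (n := n) {⟨_, gwl 1 t⟩} := by
    rintro ⟨G, H⟩ h
    -- The bound `t + k` is `t + 1` here.
    exact (mem_rho0_singleton _).2 <| gwl_eq_of_eval_eq le_rfl t fun φ hφ hfree =>
      mem_rho0_graphFuns.1 h φ ⟨Set.mem_univ φ, hφ⟩ hfree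
  have wlcr : rho0 (n := n) (ℓ := ℓ) {⟨_, gwl 1 t⟩} ⊆ rho0 {⟨_, gcr t⟩} := by
    rintro ⟨G, H⟩ h
    exact (mem_rho0_singleton _).2 (gcr_eq_of_gwl_one_eq ((mem_rho0_singleton _).1 h))
  refine ⟨⟨crTL.antisymm (TLwl.trans wlcr), TLwl.antisymm (wlcr.trans crTL)⟩, ?_⟩
  ext ⟨G, H⟩
  rw [mem_rho0_singleton, mem_rho0_graphFuns]
  exact ⟨fun h φ _ hfree ν => eval_eq_of_gwlStable_eq h φ hfree ν, fun h =>
    gwlStable_eq_of_forall_gwl_eq fun t => gwl_eq_of_eval_eq hk t fun φ _ hfree =>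
      h φ (Set.mem_univ φ) hfree⟩
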